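/- **Setting.** Let $R$ be a commutative ring (for instance a regular Noetherian ring of finite Krull dimension); sheaves are sheaves of $R$-modules, and complexes are objects of the derived category $D^+(\,\cdot\,)$ of bounded below complexes of sheaves, which contains $D^b(\,\cdot\,)$ as a full subcategory. Let $X$ be a topologically stratified space (in the sense of Goresky–MacPherson) of real dimension $2n$ with only even-dimensional strata and without isolated points, with stratification $$\mathfrak X:\ X=X_n\supseteq X_{n-1}\supseteq\cdots\supseteq X_0\supseteq X_{-1}=\varnothing$$ by closed subsets, where $X_k\setminus X_{k-1}$ has real dimension $2k$ (complex dimension $k$). For example, $X$ may be a complex algebraic variety of dimension $n$, not necessarily pure dimensional, in the classical topology, with a Whitney stratification. For $0\le m\le n$ let $U^m$ be the union of those connected components of $X_m\setminus X_{m-1}$ (the $m$-dimensional strata) which are open in $X$, let $X^m=\overline{U^m}$, with the induced filtration $\mathfrak X^m$, $X^m_k=X^m\cap X_k$, and let $a^m:X^m\to X$ be the inclusion. For $1\le k\le n+1$ put $$W_k=\bigcup_{m=n-k+2}^{n}(X^m\setminus X_{n-k}),\qquad U_k=W_k\sqcup\bigsqcup_{m=1}^{n-k+1}U^m .$$ This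 is the increasing filtration of $X$ by open subsets induced by $\mathfrak X$; one has $U_1=\bigsqcup_{m=1}^nU^m$ and $U_{n+1}=X$. Let $j_k:U_k\to U_{k+1}$ be the inclusion. Let $\mathcal L$ be a local system (a locally constant sheaf with finitely generated stalks) on $U_1$, and let $\mathcal L^m=\mathcal L|_{U^m}$. The complex $IC(\mathfrak X,\mathcal L)=I_{n+1}$ on $X$ is defined by the modified Deligne construction $$I_1=\bigoplus_{m=1}^n\mathcal L^m[m]\ \text{ on }U_1,\qquad I_{k+1}=\tau_{\le k-1-n}Rj_{k*}I_k\ \oplus\ \bigoplus_{m=1}^{n-k}\mathcal L^m[m]\ \text{ on }U_{k+1},$$ where $\mathcal L^m$ is extended by zero from the open and closed subset $U^m$. For $1\le m\le n$ the complex $IC(\mathfrak X^m,\mathcal L^m)$ on $X^m$ is the usual middle perversity Deligne–Goresky–MacPherson intersection complex of the purely $m$-dimensional space $X^m$: with $U^m_k=X^m\setminus X_{m-k}$ (so that $U^m_1=U^m$ and $U^m_{m+1}=X^m$) and the inclusions $j^m_k:U^m_k\to U^m_{k+1}$, it is $I^m_{m+1}$, where $I^m_1=\mathcal L^m[m]$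 and $I^m_{k+1}=\tau_{\le k-1-m}Rj^m_{k*}I^m_k$. **Proposition (IC is direct sum).** With this notation, $$IC(\mathfrak X,\mathcal L)\ \simeq\ \bigoplus_{m=1}^n a^m_*\,IC(\mathfrak X^m,\mathcal L^m).$$ -/

import Mathlib

open CategoryTheory Limits TopologicalSpace Topology

universe u

/-! ### Topologically stratified spaces -/

/-- The relation that glues every point `(l, 0)` of `L × [0, 1)` to the added vertex. -/
inductive ConeRel (L : Type u) : Unit ⊕ (L × Set.Ico (0 : ℝ) 1) → Unit ⊕ (L × Set.Ico (0 : ℝ) 1) → Prop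
  | glue (l : L) : ConeRel L (Sum.inl ()) (Sum.inr (l, ⟨0, by norm_num, by norm_num⟩))

/-- The open cone `L × [0, 1) / (l, 0) ∼ (l', 0)`, with the quotient topology. The vertex is added
separately, so that the open cone on the empty space is a point. -/
def OpenCone (L : Type u) : Type u := Quot (ConeRel L)

instance (L : Type u) [TopologicalSpace L] : TopologicalSpace (OpenCone L) :=
  inferInstanceAs (TopologicalSpace (Quot (ConeRel L)))

/-- The vertex of the open cone. -/
def OpenCone.vertex (L : Type u) : OpenCone L := Quot.mk _ (Sum.inl ())

/-- The class of `(l, t)` in the open cone. -/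
def OpenCone.mk {L : Type u} (l : L) (t : Set.Ico (0 : ℝ) 1) : OpenCone L :=
  Quot.mk _ (Sum.inr (l, t))

/-- The open cone on a subset `A` of `L`, as a subset of the open cone on `L`. It always contains
the vertex. -/
def OpenCone.sub {L : Type u} (A : Set L) : Set (OpenCone L) :=
  {c | c = OpenCone.vertex L ∨ ∃ l ∈ A, ∃ t, c = OpenCone.mk l t}

/-- `F` is an `r`-dimensional topological stratification of `X`, where `r` is a real dimension.
The filtration `X = X_r ⊇ ⋯ ⊇ X_0 ⊇ X_{-1} = ∅` is indexed by all integers, with `F i = X` for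
`i ≥ r` and `F i = ∅` for `i < 0`. The definition is by recursion on `r`: the links of the points
of `X_k ∖ X_{k-1}` are compact Hausdorff spaces with an `(r - k - 1)`-dimensional stratification,
which means that they are empty if `k = r`. A link embeds into `X`, or is empty, so it may be taken
in the universe of `X`. -/
def IsTopologicalStratification (r : ℕ) (X : Type u) [TopologicalSpace X] (F : ℤ → Set X) : Prop :=
  (T2Space X ∧ Monotone F ∧ (∀ i, IsClosed (F i)) ∧
    (∀ i : ℤ, i < 0 → F i = ∅) ∧ (∀ i : ℤ, (r : ℤ) ≤ i → F i = Set.univ)) ∧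
  (r = 0 → Countable X ∧ DiscreteTopology X) ∧
  (0 < r → ParacompactSpace X ∧
    ∀ (k : ℕ) (p : X), k ≤ r → p ∈ F k \ F (k - 1) →
      ∃ N ∈ 𝓝 p, ∃ (L : Type u) (_ : TopologicalSpace L) (G : ℤ → Set L),
        CompactSpace L ∧ T2Space L ∧
        (k = r → IsEmpty L) ∧
        (k < r → IsTopologicalStratification (r - k - 1) L G) ∧
        ∃ φ : (EuclideanSpace ℝ (Fin k) × OpenCone L) ≃ₜ N,
          ∀ j : ℤ, -1 ≤ j → ∀ z : EuclideanSpace ℝ (Fin k) × OpenCone L,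
            (φ z : X) ∈ F (k + j + 1) ↔ z.2 ∈ OpenCone.sub (G j))
termination_by r
decreasing_by omega

/-- `F` is a stratification `X = X_n ⊇ X_{n-1} ⊇ ⋯ ⊇ X_{-1} = ∅`, indexed by complex dimension, of
a topologically stratified space of real dimension `2 n` all of whose strata are of even dimension
(`X_i ∖ X_{i-1}` is of real dimension `2 i`), and which has no open `0`-dimensional strata, that
is, no isolated points. -/
structure IsEvenStratification (n : ℕ) {X : Type u} [TopologicalSpace X] (F : ℤ → Set X) : Prop where
  isStratification : IsTopologicalStratification (2 * n) X (fun i => F (i / 2))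
  not_isolated : ∀ x : X, ¬ IsOpen ({x} : Set X)

lemma IsEvenStratification.monotone {n : ℕ} {X : Type u} [TopologicalSpace X] {F : ℤ → Set X}
    (hF : IsEvenStratification n F) : Monotone F := by
  have h := hF.isStratification
  rw [IsTopologicalStratification] at h
  intro i j hij
  have := h.1.2.1 (show 2 * i ≤ 2 * j by omega)
  simpa using this

/-! ### The open filtration induced by a stratification -/

section OpenFiltration

variable {X : Type u} [TopologicalSpace X]

/-- `U^m`, the union of all `m`-dimensional strata which are open in `X`. The `m`-dimensional strata
are the connected components of `X_m ∖ X_{m-1}`. -/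
def openStrata (F : ℤ → Set X) (m : ℕ) : Set X :=
  {x | x ∈ F m \ F (m - 1) ∧ IsOpen (connectedComponentIn (F m \ F (m - 1)) x)}

/-- `X^m`, the closure of `U^m`. -/
def pureClosure (F : ℤ → Set X) (m : ℕ) : Set X := closure (openStrata F m)

/-- `W_k`, the union of the sets `U^m_{m-n+k} = X^m ∖ X_{n-k}` over `n - k + 2 ≤ m ≤ n`. -/
def wSet (n : ℕ) (F : ℤ → Set X) (k : ℕ) : Set X :=
  {x | ∃ m : ℕ, 1 ≤ m ∧ m ≤ n ∧ n + 2 ≤ m + k ∧ x ∈ pureClosure F m \ F (n - k)}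

/-- `U_k`, the union of `W_k` and of the sets `U^m` for `1 ≤ m ≤ n - k + 1`. -/
def openFilt (n : ℕ) (F : ℤ → Set X) (k : ℕ) : Set X :=
  wSet n F k ∪ {x | ∃ m : ℕ, 1 ≤ m ∧ m + k ≤ n + 1 ∧ x ∈ openStrata F m}

lemma openStrata_subset_openFilt {n : ℕ} (F : ℤ → Set X) {m k : ℕ} (hm : 1 ≤ m)
    (hk : m + k ≤ n + 1) : openStrata F m ⊆ openFilt n F k :=
  fun _ hx => Or.inr ⟨m, hm, hk, hx⟩

lemma openFilt_subset_succ (n : ℕ) {F : ℤ → Set X} (hF : Monotone F) (k : ℕ) :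
    openFilt n F (k + 1) ⊆ openFilt n F (k + 2) := by
  rintro x (⟨m, h1, h2, h3, hx, hx'⟩ | ⟨m, h1, h2, hx⟩)
  · exact Or.inl ⟨m, h1, h2, by omega, hx, fun h => hx' (hF (by push_cast; omega) h)⟩
  · rcases Nat.lt_or_ge (n + 1) (m + (k + 2)) with h | h
    · exact Or.inl ⟨m, h1, by omega, by omega, subset_closure hx,
        fun h => hx.1.2 (hF (by push_cast; omega) h)⟩
    · exact Or.inr ⟨m, h1, h, hx⟩

end OpenFiltration

/-! ### The sets `U^m_1` and `U_{n+1}`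

The two facts `pureClosure_diff` and `openFilt_last` below say that `U^m_1 = U^m` and
`U_{n+1} = X`. -/

section Geometry

variable {n : ℕ} {X : Type u} [TopologicalSpace X] {F : ℤ → Set X}

lemma OpenCone.sub_empty {L : Type u} {c : OpenCone L} (h : c ∈ OpenCone.sub (∅ : Set L)) :
    c = OpenCone.vertex L := by
  rcases h with h | ⟨l, hl, -⟩
  · exact h
  · exact hl.elim

lemma OpenCone.eq_vertex_or {L : Type u} (c : OpenCone L) :
    c = OpenCone.vertex L ∨ ∃ l t, c = OpenCone.mk l t := by
  induction c using Quot.ind with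
  | mk z =>
    rcases z with ⟨⟩ | ⟨l, t⟩
    · exact Or.inl rfl
    · exact Or.inr ⟨l, t, rfl⟩

/-- The height function on the open cone. -/
def OpenCone.height {L : Type u} : OpenCone L → ℝ :=
  Quot.lift (fun z => Sum.elim (fun _ => 0) (fun w => (w.2 : ℝ)) z) (by rintro _ _ ⟨l⟩; rfl)

lemma OpenCone.tendsto_vertex {L : Type u} [TopologicalSpace L] (l : L) :
    Filter.Tendsto (fun t : Set.Ico (0 : ℝ) 1 => OpenCone.mk l t) (𝓝 ⟨0, by norm_num, by norm_num⟩)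
      (𝓝 (OpenCone.vertex L)) := by
  have h : OpenCone.vertex L = OpenCone.mk l ⟨0, by norm_num, by norm_num⟩ :=
    Quot.sound (ConeRel.glue l)
  rw [h]
  have : Continuous (fun t : Set.Ico (0 : ℝ) 1 => OpenCone.mk l t) :=
    continuous_quot_mk.comp (continuous_inr.comp (Continuous.prodMk_right l))
  exact this.tendsto _

/-- The shape of a stratification near a point of `X_k ∖ X_{k-1}`: small neighborhoods `M` with
connected trace on `X_k ∖ X_{k-1}`, which is all of `M` as soon as `X_k` contains a neighborhood of
one of its points in `M`. -/
lemma IsEvenStratification.exists_nhds (hF : IsEvenStratification n F) {k : ℕ} {p : X}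
    (hp : p ∈ F k \ F (k - 1)) :
    ∃ M ∈ 𝓝 p, IsPreconnected (M ∩ F k) ∧ M ∩ F k ⊆ F k \ F (k - 1) ∧
      ((∃ t ∈ M, F k ∈ 𝓝 t) → M ⊆ F k) ∧ (k = 0 → M ∩ F k ⊆ {p}) := by
  have h := hF.isStratification
  rw [IsTopologicalStratification] at h
  obtain ⟨⟨hT2, hmono, hclosed, hneg, htop⟩, h0, h1⟩ := h
  have hdiv : ∀ i : ℕ, ((2 * i : ℕ) : ℤ) / 2 = i := fun i => by omega
  rcases Nat.eq_zero_or_pos n with rfl | hn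
  · have := (h0 rfl).2
    exact (hF.not_isolated p (isOpen_discrete _)).elim
  obtain ⟨-, hloc⟩ := h1 (by omega)
  have hkn : k ≤ n := by
    by_contra hk
    have := htop (2 * (k - 1)) (by push_cast; omega)
    rw [show (2 * ((k : ℤ) - 1)) / 2 = (k : ℤ) - 1 by omega] at this
    exact hp.2 (this ▸ Set.mem_univ p)
  obtain ⟨N, hN, L, _, G, -, -, hL, hG, φ, hφ⟩ := hloc (2 * k) p (by omega) (by
    simp only [hdiv]
    rwa [show (((2 * k : ℕ) : ℤ) - 1) / 2 = (k : ℤ) - 1 by omega])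
  have hG1 : G (-1) = ∅ := by
    rcases Nat.lt_or_ge (2 * k) (2 * n) with h | h
    · have h' := hG h
      rw [IsTopologicalStratification] at h'
      exact h'.1.2.2.2.1 (-1) (by norm_num)
    · have := hL (by omega)
      exact Set.eq_empty_of_isEmpty _
  have hmem : ∀ z, (φ z : X) ∈ F k ↔ z.2 = OpenCone.vertex L := fun z => by
    have h := hφ (-1) le_rfl z
    rw [show (((2 * k : ℕ) : ℤ) + -1 + 1) / 2 = (k : ℤ) by omega, hG1] at h
    exact h.trans ⟨OpenCone.sub_empty, Or.inl⟩
  have hcl : IsClosed (F (k - 1)) := by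
    simpa using hclosed (2 * (k - 1))
  obtain ⟨⟨v₀, c₀⟩, hz₀⟩ := φ.surjective ⟨p, mem_of_mem_nhds hN⟩
  obtain rfl : c₀ = OpenCone.vertex L := (hmem (v₀, c₀)).1 (by rw [hz₀]; exact hp.1)
  have hc : Continuous fun v => (φ (v, OpenCone.vertex L) : X) :=
    continuous_subtype_val.comp (φ.continuous.comp (Continuous.prodMk_left _))
  obtain ⟨ε, hε, hball⟩ := Metric.isOpen_iff.1 (hcl.isOpen_compl.preimage hc) v₀
    (by simp only [Set.mem_preimage, hz₀]; exact hp.2)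
  have hM : Subtype.val '' (φ '' {z | z.1 ∈ Metric.ball v₀ ε}) ∩ F k =
      (fun v => (φ (v, OpenCone.vertex L) : X)) '' Metric.ball v₀ ε := by
    ext x
    constructor
    · rintro ⟨⟨_, ⟨⟨v, c⟩, hv, rfl⟩, rfl⟩, hx⟩
      obtain rfl : c = OpenCone.vertex L := (hmem _).1 hx
      exact ⟨v, hv, rfl⟩
    · rintro ⟨v, hv, rfl⟩
      exact ⟨Set.mem_image_of_mem _ (Set.mem_image_of_mem φ
        (show (v, OpenCone.vertex L).1 ∈ Metric.ball v₀ ε from hv)), (hmem _).2 rfl⟩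
  refine ⟨Subtype.val '' (φ '' {z | z.1 ∈ Metric.ball v₀ ε}), ?_, ?_, ?_, ?_, ?_⟩
  · have ho' : IsOpen {z : EuclideanSpace ℝ (Fin (2 * k)) × OpenCone L |
        z.1 ∈ Metric.ball v₀ ε} := Metric.isOpen_ball.preimage continuous_fst
    have ho : IsOpen (φ '' {z | z.1 ∈ Metric.ball v₀ ε}) := φ.isOpen_image.2 ho'
    rw [← map_nhds_subtype_coe_eq_nhds (mem_of_mem_nhds hN) hN]
    refine Filter.image_mem_map (ho.mem_nhds ?_)
    rw [← hz₀]
    exact Set.mem_image_of_mem φ (Metric.mem_ball_self hε)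
  · rw [hM]
    exact (convex_ball v₀ ε).isPreconnected.image _ hc.continuousOn
  · rw [hM]
    rintro _ ⟨v, hv, rfl⟩
    exact ⟨(hmem _).2 rfl, hball hv⟩
  · rintro ⟨_, ⟨_, ⟨⟨v, c⟩, hv, rfl⟩, rfl⟩, ht⟩
    obtain rfl : c = OpenCone.vertex L := (hmem _).1 (mem_of_mem_nhds ht)
    have hLe : IsEmpty L := by
      refine ⟨fun l => ?_⟩
      have h := ((continuous_subtype_val.comp
        (φ.continuous.comp (Continuous.prodMk_right v))).tendsto _).comp
          (OpenCone.tendsto_vertex l)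
      obtain ⟨δ, hδ, hd⟩ := Metric.mem_nhds_iff.1 (h ht)
      have hm : min (δ / 2) (1 / 2) ∈ Set.Ico (0 : ℝ) 1 :=
        ⟨by positivity, (min_le_right _ _).trans_lt (by norm_num)⟩
      have := hd (show (⟨_, hm⟩ : Set.Ico (0 : ℝ) 1) ∈ _ by
        rw [Metric.mem_ball, Subtype.dist_eq, Real.dist_eq, sub_zero, abs_of_nonneg hm.1]
        exact (min_le_left _ _).trans_lt (by linarith))
      have h2 := congrArg OpenCone.height ((hmem _).1 this)
      have h3 : min (δ / 2) (1 / 2) = 0 := h2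
      have : 0 < min (δ / 2) (1 / 2 : ℝ) := by positivity
      linarith
    rintro _ ⟨_, ⟨⟨w, c⟩, -, rfl⟩, rfl⟩
    refine (hmem _).2 ?_
    rcases OpenCone.eq_vertex_or c with h | ⟨l, -, -⟩
    · exact h
    · exact isEmptyElim l
  · rintro rfl
    rw [hM]
    rintro _ ⟨v, -, rfl⟩
    have : Subsingleton (EuclideanSpace ℝ (Fin (2 * 0))) :=
      inferInstanceAs (Subsingleton (EuclideanSpace ℝ (Fin 0)))
    obtain rfl : v = v₀ := Subsingleton.elim _ _
    exact congrArg Subtype.val hz₀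

lemma IsEvenStratification.isClosed (hF : IsEvenStratification n F) (i : ℤ) : IsClosed (F i) := by
  have h := hF.isStratification
  rw [IsTopologicalStratification] at h
  simpa using h.1.2.2.1 (2 * i)

lemma IsEvenStratification.eq_empty (hF : IsEvenStratification n F) {i : ℤ} (hi : i < 0) :
    F i = ∅ := by
  have h := hF.isStratification
  rw [IsTopologicalStratification] at h
  simpa using h.1.2.2.2.1 (2 * i) (by omega)

lemma IsEvenStratification.eq_univ (hF : IsEvenStratification n F) {i : ℤ} (hi : n ≤ i) :
    F i = Set.univ := by
  have h := hF.isStratification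
  rw [IsTopologicalStratification] at h
  simpa using h.1.2.2.2.2 (2 * i) (by push_cast; omega)

/-- The frontier of `U^m` lies in `X_{m-1}`, that is, `U^m_1 = X^m ∖ X_{m-1}` is equal to `U^m`. -/
lemma IsEvenStratification.pureClosure_diff (hF : IsEvenStratification n F) (m : ℕ) :
    pureClosure F m \ F (m - 1) = openStrata F m := by
  refine Set.Subset.antisymm ?_ fun x hx => ⟨subset_closure hx, hx.1.2⟩
  rintro p ⟨hp, hp'⟩
  have hpm : p ∈ F m := closure_minimal (fun x hx => hx.1.1) (hF.isClosed m) hp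
  obtain ⟨M, hM, hconn, hsub, -, -⟩ := hF.exists_nhds ⟨hpm, hp'⟩
  obtain ⟨y, hyM, hy⟩ := mem_closure_iff_nhds.1 hp M hM
  refine ⟨⟨hpm, hp'⟩, ?_⟩
  rw [← connectedComponentIn_eq (hconn.subset_connectedComponentIn ⟨hyM, hy.1.1⟩ hsub
    ⟨mem_of_mem_nhds hM, hpm⟩)]
  exact hy.2

/-- The sets `U^m` for `1 ≤ m ≤ n` have a dense union. -/
lemma IsEvenStratification.exists_mem_pureClosure (hF : IsEvenStratification n F) (x : X) :
    ∃ m : ℕ, 1 ≤ m ∧ m ≤ n ∧ x ∈ pureClosure F m := by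
  have key : Dense (⋃ m ∈ Finset.Icc 1 n, openStrata F m) := by
    refine dense_iff_inter_open.2 fun V hV ⟨x₀, hx₀⟩ => ?_
    have hex : ∃ k : ℕ, V ⊆ F k := ⟨n, by rw [hF.eq_univ le_rfl]; exact Set.subset_univ V⟩
    classical
    obtain ⟨k, hk, hmin⟩ : ∃ k : ℕ, V ⊆ F k ∧ ¬ V ⊆ F (k - 1) := by
      refine ⟨Nat.find hex, Nat.find_spec hex, fun h => ?_⟩
      rcases Nat.eq_zero_or_pos (Nat.find hex) with h0 | h0
      · rw [h0, hF.eq_empty (by norm_num)] at h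
        exact h hx₀
      · exact Nat.find_min hex (Nat.sub_lt h0 one_pos) (by rwa [Nat.cast_pred h0])
    obtain ⟨p, hpV, hp⟩ := Set.not_subset.1 hmin
    have hpk : p ∈ F k \ F (k - 1) := ⟨hk hpV, hp⟩
    have hpi : p ∈ interior (F k) := mem_interior_iff_mem_nhds.2
      (Filter.mem_of_superset (hV.mem_nhds hpV) hk)
    have hS : connectedComponentIn (F k \ F (k - 1)) p ⊆ interior (F k) := by
      refine isPreconnected_connectedComponentIn.subset_of_closure_inter_subset isOpen_interior
        ⟨p, mem_connectedComponentIn hpk, hpi⟩ ?_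
      rintro q ⟨hq, hqS⟩
      obtain ⟨M, hM, -, -, h, -⟩ := hF.exists_nhds (connectedComponentIn_subset _ _ hqS)
      obtain ⟨t, htM, ht⟩ := mem_closure_iff_nhds.1 hq M hM
      exact mem_interior_iff_mem_nhds.2 (Filter.mem_of_superset hM
        (h ⟨t, htM, mem_interior_iff_mem_nhds.1 ht⟩))
    have hopen : IsOpen (connectedComponentIn (F k \ F (k - 1)) p) := by
      refine isOpen_iff_mem_nhds.2 fun q hq => ?_
      obtain ⟨M, hM, hc, hsub, h, -⟩ := hF.exists_nhds (connectedComponentIn_subset _ _ hq)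
      have hMF := h ⟨q, mem_of_mem_nhds hM, mem_interior_iff_mem_nhds.1 (hS hq)⟩
      rw [Set.inter_eq_left.2 hMF] at hc hsub
      rw [connectedComponentIn_eq hq]
      exact Filter.mem_of_superset hM (hc.subset_connectedComponentIn (mem_of_mem_nhds hM) hsub)
    have hk1 : k ≠ 0 := by
      intro hk0
      obtain ⟨M, hM, -, -, h, h'⟩ := hF.exists_nhds hpk
      have hMF := h ⟨p, mem_of_mem_nhds hM, mem_interior_iff_mem_nhds.1 hpi⟩
      have hMp := h' hk0
      rw [Set.inter_eq_left.2 hMF] at hMp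
      refine hF.not_isolated p (isOpen_iff_mem_nhds.2 ?_)
      rintro _ rfl
      exact Filter.mem_of_superset hM hMp
    have hkn : k ≤ n := by
      by_contra h
      rw [hF.eq_univ (by omega)] at hp
      exact hp (Set.mem_univ p)
    exact ⟨p, hpV, Set.mem_biUnion (Finset.mem_Icc.2 ⟨by omega, hkn⟩) ⟨hpk, hopen⟩⟩
  have := key x
  rw [Finset.closure_biUnion] at this
  simp only [Set.mem_iUnion] at this
  obtain ⟨m, hm, h⟩ := this
  exact ⟨m, (Finset.mem_Icc.1 hm).1, (Finset.mem_Icc.1 hm).2, h⟩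

/-- `U_{n+1} = X`. -/
lemma IsEvenStratification.openFilt_last (hF : IsEvenStratification n F) :
    openFilt n F (n + 1) = Set.univ := by
  refine Set.eq_univ_of_forall fun x => ?_
  obtain ⟨m, h1, h2, hx⟩ := hF.exists_mem_pureClosure x
  refine Or.inl ⟨m, h1, h2, by omega, hx, ?_⟩
  rw [hF.eq_empty (by push_cast; omega)]
  exact Set.notMem_empty x

end Geometry

/-! ### Sheaves of `R`-modules and the derived pushforward -/

section Sheaves

variable (R : Type u) [CommRing R]

/-- The category of sheaves of `R`-modules on `Y`. -/
abbrev ModSheaf (Y : TopCat.{u}) := TopCat.Sheaf (ModuleCat.{u} R) Y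

noncomputable instance (Y : TopCat.{u}) : HasDerivedCategory.{u + 1} (ModSheaf R Y) :=
  HasDerivedCategory.standard _

instance {Y Z : TopCat.{u}} (f : Y ⟶ Z) :
    (TopCat.Sheaf.pushforward (ModuleCat.{u} R) f).Additive where
  map_add := rfl

/-- The bounded below derived category of sheaves of `R`-modules on `Y`. It contains the bounded
derived category as a full subcategory. -/
abbrev DPlus (Y : TopCat.{u}) := DerivedCategory.Plus (ModSheaf R Y)

variable {R}

/-- The derived pushforward `Rf_*`. If `f` is the inclusion of a closed subspace, then `f_*` is
exact and `Rf_*` is `f_*` applied in each degree. -/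
noncomputable def derivedPushforward {Y Z : TopCat.{u}} (f : Y ⟶ Z) : DPlus R Y ⥤ DPlus R Z :=
  (TopCat.Sheaf.pushforward (ModuleCat.{u} R) f).rightDerivedFunctorPlus

/-- The truncation functor `τ_{≤ a}` of the standard t-structure. -/
noncomputable def truncLE {Y : TopCat.{u}} (a : ℤ) : DPlus R Y ⥤ DPlus R Y :=
  (DerivedCategory.Plus.TStructure.t (C := ModSheaf R Y)).truncLE a

/-- The complex `G[d]`, which is the sheaf `G` in degree `-d`. -/
noncomputable def shiftedSheaf {Y : TopCat.{u}} (G : ModSheaf R Y) (d : ℤ) : DPlus R Y :=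
  ((DerivedCategory.Plus.singleFunctor (ModSheaf R Y) 0).obj G)⟦d⟧

/-- A local system: a locally constant sheaf of `R`-modules with finitely generated stalks. -/
structure IsLocalSystem {Y : TopCat.{u}} (G : ModSheaf R Y) : Prop where
  locally_constant : ∀ y : Y, ∃ V : Opens Y, y ∈ V ∧
    Sheaf.IsConstant (Opens.grothendieckTopology ((Opens.toTopCat Y).obj V))
      ((TopCat.Sheaf.pullback (ModuleCat.{u} R) V.inclusion').obj G)
  finite_stalk : ∀ y : Y, Module.Finite R ((TopCat.Presheaf.stalk G.presheaf y : ModuleCat.{u} R) : Type u)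

end Sheaves

/-- The inclusion of a subset `A` into a larger subset `B`, as a map of topological spaces. -/
def subsetIncl {X : Type u} [TopologicalSpace X] {A B : Set X} (h : A ⊆ B) :
    TopCat.of A ⟶ TopCat.of B :=
  TopCat.ofHom ⟨Set.inclusion h, continuous_inclusion h⟩

/-- The inclusion of a subset `A` of `X`, as a map of topological spaces. -/
def valIncl {X : Type u} [TopologicalSpace X] (A : Set X) : TopCat.of A ⟶ TopCat.of X :=
  TopCat.ofHom ⟨Subtype.val, continuous_subtype_val⟩

/-! ### The Deligne-Goresky-MacPherson intersection complex -/

section Pure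

/-- The open sets `U_k = Y ∖ Y_{d-k}` of the usual Deligne construction, for a space `Y` of pure
complex dimension `d`. -/
def pureOpenFilt {Y : Type u} (d : ℕ) (F : ℤ → Set Y) (k : ℕ) : Set Y := (F (d - k))ᶜ

lemma pureOpenFilt_subset_succ {Y : Type u} (d : ℕ) {F : ℤ → Set Y} (hF : Monotone F) (k : ℕ) :
    pureOpenFilt d F k ⊆ pureOpenFilt d F (k + 1) :=
  Set.compl_subset_compl.mpr (hF (by push_cast; omega))

variable {R : Type u} [CommRing R] {Y : Type u} [TopologicalSpace Y]

/-- The complexes of the usual Deligne construction with the middle perversity. The complex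
`pureDeligne d hF G k` is `I_{k+1}` on `U_{k+1}`: one has `I_1 = G[d]` and
`I_{k+2} = τ_{≤ k-d} Rj_{k+1 *} I_{k+1}`. -/
noncomputable def pureDeligne (d : ℕ) {F : ℤ → Set Y} (hF : Monotone F)
    (G : ModSheaf R (TopCat.of (pureOpenFilt d F 1))) :
    ∀ k : ℕ, DPlus R (TopCat.of (pureOpenFilt d F (k + 1)))
  | 0 => shiftedSheaf G d
  | k + 1 => (truncLE ((k : ℤ) - d)).obj
      ((derivedPushforward (subsetIncl (pureOpenFilt_subset_succ d hF (k + 1)))).obj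
        (pureDeligne d hF G k))

/-- The Deligne-Goresky-MacPherson intersection complex of a space `Y` of pure complex dimension
`d`: the complex `I_{d+1}` on `U_{d+1} = Y ∖ Y_{-1} = Y`, where `Y_{-1} = ∅`. -/
noncomputable def pureIC (d : ℕ) {F : ℤ → Set Y} (hF : Monotone F)
    (G : ModSheaf R (TopCat.of (pureOpenFilt d F 1))) : DPlus R (TopCat.of Y) :=
  (derivedPushforward (valIncl (pureOpenFilt d F (d + 1)))).obj (pureDeligne d hF G d)

end Pure

/-! ### The modified Deligne construction -/

section Modified

variable {R : Type u} [CommRing R] {X : Type u} [TopologicalSpace X]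

/-- `L^m`, the restriction to `U^m` of a sheaf `L` on `U_1`, for `1 ≤ m ≤ n`. -/
noncomputable def componentSheaf {n : ℕ} {F : ℤ → Set X}
    (L : ModSheaf R (TopCat.of (openFilt n F 1))) (m : ℕ) (hm : 1 ≤ m ∧ m ≤ n) :
    ModSheaf R (TopCat.of (openStrata F m)) :=
  (TopCat.Sheaf.pullback (ModuleCat.{u} R)
    (subsetIncl (openStrata_subset_openFilt F hm.1 (by omega)))).obj L

/-- The complex `L^m[m]` on `U_k`, for `1 ≤ m ≤ n - k + 1`. The sheaf `L^m` on the open and closed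
subset `U^m` of `U_k` is extended by zero to `U_k`, that is, pushed forward to `U_k`. -/
noncomputable def extendedComponent {n : ℕ} {F : ℤ → Set X}
    (L : ModSheaf R (TopCat.of (openFilt n F 1))) (k : ℕ) (hk : 1 ≤ k) (m : ℕ)
    (hm : 1 ≤ m ∧ m + k ≤ n + 1) : DPlus R (TopCat.of (openFilt n F k)) :=
  shiftedSheaf ((TopCat.Sheaf.pushforward (ModuleCat.{u} R)
    (subsetIncl (openStrata_subset_openFilt F hm.1 hm.2))).obj
      (componentSheaf L m ⟨hm.1, by omega⟩)) m

/-- The complexes of the modified Deligne construction. The complex `modifiedDeligne n hF L k` is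
`I_{k+1}` on `U_{k+1}`: one has `I_1 = ⨁_{1 ≤ m ≤ n} L^m[m]` and
`I_{k+2} = τ_{≤ k-n} Rj_{k+1 *} I_{k+1} ⊕ ⨁_{1 ≤ m ≤ n-k-1} L^m[m]`. -/
noncomputable def modifiedDeligne (n : ℕ) {F : ℤ → Set X} (hF : Monotone F)
    (L : ModSheaf R (TopCat.of (openFilt n F 1))) :
    ∀ k : ℕ, DPlus R (TopCat.of (openFilt n F (k + 1)))
  | 0 => ⨁ fun m : {m : ℕ // m ∈ Finset.Icc 1 n} =>
      extendedComponent L (0 + 1) le_rfl m.1 (by have := Finset.mem_Icc.mp m.2; omega)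
  | k + 1 =>
      (truncLE ((k : ℤ) - n)).obj
        ((derivedPushforward (subsetIncl (openFilt_subset_succ n hF k))).obj
          (modifiedDeligne n hF L k)) ⊞
      ⨁ fun m : {m : ℕ // m ∈ Finset.Icc 1 (n - (k + 1))} =>
        extendedComponent L (k + 2) (by omega) m.1 (by have := Finset.mem_Icc.mp m.2; omega)

/-- The complex `IC(𝔛, L)`: the complex `I_{n+1}` on `U_{n+1} = X`. The map
`U_{n+1} → X` is a homeomorphism by `IsEvenStratification.openFilt_last`. -/
noncomputable def modifiedIC (n : ℕ) {F : ℤ → Set X} (hF : Monotone F)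
    (L : ModSheaf R (TopCat.of (openFilt n F 1))) : DPlus R (TopCat.of X) :=
  (derivedPushforward (valIncl (openFilt n F (n + 1)))).obj (modifiedDeligne n hF L n)

/-- The filtration `X^m_k = X^m ∩ X_k` of the space `X^m`. -/
def pureFilt (F : ℤ → Set X) (m : ℕ) : ℤ → Set (pureClosure F m) :=
  fun k => Subtype.val ⁻¹' F k

lemma pureFilt_monotone {F : ℤ → Set X} (hF : Monotone F) (m : ℕ) : Monotone (pureFilt F m) :=
  fun _ _ h => Set.preimage_mono (hF h)

/-- The identification of `U^m` with the open subset `U^m_1 = X^m ∖ X_{m-1}` of `X^m`.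
It is a homeomorphism by `IsEvenStratification.pureClosure_diff`. -/
def openStrataToPure (F : ℤ → Set X) (m : ℕ) :
    TopCat.of (openStrata F m) ⟶ TopCat.of (pureOpenFilt m (pureFilt F m) 1) :=
  TopCat.ofHom ⟨fun x => ⟨⟨x.1, subset_closure x.2⟩, x.2.1.2⟩,
    (continuous_subtype_val.subtype_mk _).subtype_mk _⟩

/-- The complex `IC(𝔛^m, L^m)` on `X^m`: the Deligne-Goresky-MacPherson intersection complex of the
space `X^m` of pure complex dimension `m`, with the induced stratification and the sheaf `L^m` on
its open subset `U^m`. -/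
noncomputable def componentIC {n : ℕ} {F : ℤ → Set X} (hF : Monotone F)
    (L : ModSheaf R (TopCat.of (openFilt n F 1))) (m : ℕ) (hm : 1 ≤ m ∧ m ≤ n) :
    DPlus R (TopCat.of (pureClosure F m)) :=
  pureIC m (pureFilt_monotone hF m)
    ((TopCat.Sheaf.pushforward (ModuleCat.{u} R) (openStrataToPure F m)).obj
      (componentSheaf L m hm))

end Modified

/-!
The two constructions are compared on each open set `U_{k+1}`. Write `U^m_{i+1} = X^m ∖ X_{m-i-1}`
for the open subsets of `X^m`. If `m + k = n + i`, then `U^m_{i+1}` is equal to `X^m ∩ U_{k+1}`, so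
it is a closed subset of `U_{k+1}`
(`IsEvenStratification.isClosedEmbedding_pureIncl`); its inclusion is called `b` below.

By induction on `k`, the complex `I_{k+1}` of the modified Deligne construction is the direct sum
over `1 ≤ m ≤ n` of the complexes `b_* I^m_{i+1}` for `m + k = n + i`, and of `L^m[m]`, extended by
zero, for `m + k < n` (`nonempty_modifiedDeligne_iso`). In the induction step, `τ_{≤ k-n} Rj_*` is
applied to each summand.
* If `m + k < n`, then `Rj_*` of `L^m[m]` lives in degrees at least `-m > k - n`, so the truncation
  kills it (`isZero_truncLE_componentStage`). The summand `L^m[m]` which is added to `I_{k+2}`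
  replaces it.
* If `m + k = n + i`, then `Rj_* b_* = b_* Rj^m_*`, and `b_*` commutes with the truncation since it
  is exact. As `k - n = i - m`, the result is `b_* I^m_{i+2}` (`nonempty_truncLE_componentStage`).
For `k = n` the pushforward to `X` gives the assertion.

Only isomorphisms of objects are needed, so every statement about a derived functor is verified on
bounded below complexes of injectives, where the derived functor is computed termwise. This gives
the composition rule `R(GF) = RG ∘ RF` when `F` preserves injectives, left t-exactness, and the
comparison of `RF` with the functor induced by `F` on derived categories when `F` is exact.
The pushforward of sheaves preserves injectives since its left adjoint is exact, and it is exact for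
a closed embedding, because off the image all sections are locally zero.
-/

/-! ### Right derived functors on bounded below derived categories -/

namespace CategoryTheory.Functor

open _root_.DerivedCategory Pretriangulated Triangulated

variable {A B C : Type*} [Category* A] [Category* B] [Category* C] [Abelian A] [Abelian B]
  [Abelian C] [HasDerivedCategory A] [HasDerivedCategory B] [HasDerivedCategory C]

section Injectives

variable [EnoughInjectives A]

lemma exists_injective_iso_Qh (X : DerivedCategory.Plus A) :
    ∃ K : HomotopyCategory.Plus A, (∀ n, Injective (K.obj.as.X n)) ∧
      Nonempty (Plus.Qh.obj K ≅ X) := by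
  obtain ⟨L, ⟨e⟩⟩ := Functor.EssSurj.mem_essImage
    (F := (InjectiveObject.ι A).mapHomotopyCategoryPlus ⋙ DerivedCategory.Plus.Qh) X
  exact ⟨(InjectiveObject.ι A).mapHomotopyCategoryPlus.obj L, fun n => inferInstance, ⟨e⟩⟩

variable (F : A ⥤ B) [F.Additive]

/-- On a bounded below complex `K` of injectives, the right derived functor of `F` is computed by
applying `F` termwise. -/
noncomputable def rightDerivedFunctorPlusObjIso (K : HomotopyCategory.Plus A)
    [∀ n, Injective (K.obj.as.X n)] :
    F.rightDerivedFunctorPlus.obj (Plus.Qh.obj K) ≅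
      Plus.Qh.obj (F.mapHomotopyCategoryPlus.obj K) :=
  (asIso (F.rightDerivedFunctorPlusUnit.app K)).symm

instance : ((InjectiveObject.ι A).mapHomotopyCategoryPlus ⋙ DerivedCategory.Plus.Qh).Full where
  map_surjective {X Y} f := by
    have hY : CochainComplex.IsKInjective
        ((InjectiveObject.ι A).mapHomotopyCategoryPlus.obj Y).1.as := by
      obtain ⟨Y, rfl⟩ := HomotopyCategory.Plus.quotient_obj_surjective Y
      exact inferInstanceAs (CochainComplex.IsKInjective
        (((InjectiveObject.ι A).mapHomologicalComplex (.up ℤ)).obj Y.obj))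
    obtain ⟨g, rfl⟩ := (Plus.Qh_map_bijective_of_isKInjective _ _ hY).2 f
    obtain ⟨h, rfl⟩ := (InjectiveObject.ι A).mapHomotopyCategoryPlus.map_surjective g
    exact ⟨h, rfl⟩

/-- Bounded below complexes of injectives form a category which maps fully and essentially
surjectively to the bounded below derived category, and the derived functor restricts to an additive
functor on it. -/
instance : F.rightDerivedFunctorPlus.Additive := by
  have : (((InjectiveObject.ι A).mapHomotopyCategoryPlus ⋙ DerivedCategory.Plus.Qh) ⋙
      F.rightDerivedFunctorPlus).Additive :=
    Functor.additive_of_iso (NatIso.ofComponents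
      (F := (InjectiveObject.ι A).mapHomotopyCategoryPlus ⋙ F.mapHomotopyCategoryPlus ⋙
        DerivedCategory.Plus.Qh)
      (fun X => asIso (F.rightDerivedFunctorPlusUnit.app
        ((InjectiveObject.ι A).mapHomotopyCategoryPlus.obj X)))
      (fun f => F.rightDerivedFunctorPlusUnit.naturality _))
  exact Functor.additive_of_full_essSurj_comp
    ((InjectiveObject.ι A).mapHomotopyCategoryPlus ⋙ DerivedCategory.Plus.Qh) _

/-- Right derived functors are left t-exact. -/
lemma isGE_rightDerivedFunctorPlus_obj (X : DerivedCategory.Plus A) (n : ℤ) [X.IsGE n] :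
    (F.rightDerivedFunctorPlus.obj X).IsGE n := by
  obtain ⟨L, hL, ⟨e⟩⟩ := DerivedCategory.Plus.exists_injective_nonempty_iso X n
  let K := (HomotopyCategory.Plus.quotient A).obj
    ((InjectiveObject.ι A).mapCochainComplexPlus.obj L)
  let e' := F.rightDerivedFunctorPlus.mapIso e.symm ≪≫ F.rightDerivedFunctorPlusObjIso K
  let M : CochainComplex B ℤ := (F.mapHomologicalComplex (.up ℤ)).obj
    (((InjectiveObject.ι A).mapHomologicalComplex (.up ℤ)).obj L.obj)
  have : M.IsStrictlyGE n := inferInstance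
  have h : (Plus.Qh.obj (F.mapHomotopyCategoryPlus.obj K)).IsGE n := by
    rw [← Plus.isGE_ι_obj_iff]
    exact _root_.DerivedCategory.TStructure.t.isGE_of_iso ((quotientCompQhIso B).symm.app M) n
  exact Plus.TStructure.t.isGE_of_iso e'.symm n

variable (G : B ⥤ C) [G.Additive] (H : A ⥤ C) [H.Additive] [EnoughInjectives B]

/-- The derived functor of a composition `H = G ∘ F`, when `F` preserves injective objects. -/
lemma nonempty_rightDerivedFunctorPlus_comp (e : F ⋙ G ≅ H) [F.PreservesInjectiveObjects]
    (X : DerivedCategory.Plus A) :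
    Nonempty (H.rightDerivedFunctorPlus.obj X ≅
      G.rightDerivedFunctorPlus.obj (F.rightDerivedFunctorPlus.obj X)) := by
  obtain ⟨K, hK, ⟨i⟩⟩ := exists_injective_iso_Qh X
  have : ∀ n, Injective ((F.mapHomotopyCategoryPlus.obj K).obj.as.X n) := fun n =>
    inferInstanceAs (Injective (F.obj (K.obj.as.X n)))
  exact ⟨H.rightDerivedFunctorPlus.mapIso i.symm ≪≫ H.rightDerivedFunctorPlusObjIso K ≪≫
    Plus.Qh.mapIso ((mapHomotopyCategoryPlusCompIso e).symm.app K) ≪≫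
    (G.rightDerivedFunctorPlusObjIso _).symm ≪≫
    G.rightDerivedFunctorPlus.mapIso ((F.rightDerivedFunctorPlusObjIso K).symm ≪≫
      F.rightDerivedFunctorPlus.mapIso i)⟩

end Injectives

section Exact

variable (F : A ⥤ B) [F.Additive] [PreservesFiniteLimits F] [PreservesFiniteColimits F]

lemma isLE_mapDerivedCategory_obj (X : DerivedCategory A) (n : ℤ) [X.IsLE n] :
    (F.mapDerivedCategory.obj X).IsLE n := by
  obtain ⟨K, _, ⟨e⟩⟩ := X.exists_iso_Q_obj_of_isLE n
  exact _root_.DerivedCategory.TStructure.t.isLE_of_iso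
    (X := Q.obj ((F.mapHomologicalComplex (.up ℤ)).obj K))
    (F.mapDerivedCategory.mapIso e ≪≫ F.mapDerivedCategoryFactors.app K).symm n

lemma isGE_mapDerivedCategory_obj (X : DerivedCategory A) (n : ℤ) [X.IsGE n] :
    (F.mapDerivedCategory.obj X).IsGE n := by
  obtain ⟨K, _, ⟨e⟩⟩ := X.exists_iso_Q_obj_of_isGE n
  exact _root_.DerivedCategory.TStructure.t.isGE_of_iso
    (X := Q.obj ((F.mapHomologicalComplex (.up ℤ)).obj K))
    (F.mapDerivedCategory.mapIso e ≪≫ F.mapDerivedCategoryFactors.app K).symm n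

variable [EnoughInjectives A]

/-- The right derived functor of an exact functor `F` is given by `F` applied in each degree. -/
lemma nonempty_ι_rightDerivedFunctorPlus_obj (X : DerivedCategory.Plus A) :
    Nonempty (Plus.ι.obj (F.rightDerivedFunctorPlus.obj X) ≅
      F.mapDerivedCategory.obj (Plus.ι.obj X)) := by
  obtain ⟨K, hK, ⟨i⟩⟩ := exists_injective_iso_Qh X
  exact ⟨Plus.ι.mapIso (F.rightDerivedFunctorPlus.mapIso i.symm ≪≫
    F.rightDerivedFunctorPlusObjIso K) ≪≫ (F.mapDerivedCategoryFactorsh.app K.obj).symm ≪≫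
    F.mapDerivedCategory.mapIso (Plus.ι.mapIso i)⟩

/-- The right derived functor of an exact functor commutes with truncations: it sends the truncation
triangle of `X` to a triangle of the same kind, and truncation triangles are unique. -/
lemma nonempty_truncLE_rightDerivedFunctorPlus (X : DerivedCategory.Plus A) (n : ℤ) :
    Nonempty ((Plus.TStructure.t.truncLE n).obj (F.rightDerivedFunctorPlus.obj X) ≅
      F.rightDerivedFunctorPlus.obj ((Plus.TStructure.t.truncLE n).obj X)) := by
  obtain ⟨e₁⟩ := F.nonempty_ι_rightDerivedFunctorPlus_obj ((Plus.TStructure.t.truncLE n).obj X)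
  obtain ⟨e₂⟩ := F.nonempty_ι_rightDerivedFunctorPlus_obj X
  have h₁ := Plus.ι.map_distinguished _
    (Plus.TStructure.t.triangleLEGT_distinguished n (F.rightDerivedFunctorPlus.obj X))
  have h₂ := F.mapDerivedCategory.map_distinguished _ (Plus.ι.map_distinguished _
    (Plus.TStructure.t.triangleLEGT_distinguished n X))
  obtain ⟨e, -⟩ := _root_.DerivedCategory.TStructure.t.triangle_iso_exists h₁ h₂ e₂ n (n + 1)
    (inferInstanceAs ((Plus.ι.obj ((Plus.TStructure.t.truncLE n).obj _)).IsLE n))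
    (inferInstanceAs ((Plus.ι.obj ((Plus.TStructure.t.truncGT n).obj _)).IsGE (n + 1)))
    (F.isLE_mapDerivedCategory_obj (Plus.ι.obj ((Plus.TStructure.t.truncLE n).obj X)) n)
    (F.isGE_mapDerivedCategory_obj (Plus.ι.obj ((Plus.TStructure.t.truncGT n).obj X)) (n + 1))
  exact ⟨Plus.ι.preimageIso (Triangle.π₁.mapIso e ≪≫ e₁.symm)⟩

lemma nonempty_rightDerivedFunctorPlus_shift_single (X : A) (d : ℤ) :
    Nonempty (F.rightDerivedFunctorPlus.obj (((Plus.singleFunctor A 0).obj X)⟦d⟧) ≅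
      ((Plus.singleFunctor B 0).obj (F.obj X))⟦d⟧) := by
  obtain ⟨e⟩ := F.nonempty_ι_rightDerivedFunctorPlus_obj (((Plus.singleFunctor A 0).obj X)⟦d⟧)
  exact ⟨Plus.ι.preimageIso (e ≪≫
    F.mapDerivedCategory.mapIso ((Plus.ι.commShiftIso d).app _) ≪≫
    (F.mapDerivedCategory.commShiftIso d).app _ ≪≫
    (shiftFunctor _ d).mapIso ((F.mapDerivedCategorySingleFunctor 0).app X) ≪≫
    ((Plus.ι.commShiftIso d).app ((Plus.singleFunctor B 0).obj (F.obj X))).symm)⟩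

end Exact

end CategoryTheory.Functor

/-! ### Derived pushforward of sheaves -/

section Pushforward

variable (R : Type u) [CommRing R] {Y Z T : TopCat.{u}}

set_option synthInstance.maxHeartbeats 400000 in
lemma preservesFiniteLimits_pullback (f : Y ⟶ Z) :
    PreservesFiniteLimits (TopCat.Sheaf.pullback (ModuleCat.{u} R) f) := by
  have : ReflectsLimits (forget (ModuleCat.{u} R)) := reflectsLimits_of_reflectsIsomorphisms
  have : PreservesFiniteLimits ((Opens.map f).op.lan : _ ⥤ (_ ⥤ ModuleCat.{u} R)) :=
    lan_preservesFiniteLimits_of_flat _ _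
  exact Functor.sheafPullbackConstruction.preservesFiniteLimits _ _ _ _

/-- The pushforward is right adjoint to the pullback, which is exact. -/
instance (f : Y ⟶ Z) :
    (TopCat.Sheaf.pushforward (ModuleCat.{u} R) f).PreservesInjectiveObjects := by
  have := preservesFiniteLimits_pullback R f
  exact Functor.preservesInjectiveObjects_of_adjunction_of_preservesMonomorphisms
    (TopCat.Sheaf.pullbackPushforwardAdjunction (ModuleCat.{u} R) f)

/-- The pushforward along a composition is the composition of the pushforwards. -/
noncomputable def pushforwardCompIso (f : Y ⟶ Z) (g : Z ⟶ T) :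
    TopCat.Sheaf.pushforward (ModuleCat.{u} R) f ⋙ TopCat.Sheaf.pushforward (ModuleCat.{u} R) g ≅
      TopCat.Sheaf.pushforward (ModuleCat.{u} R) (f ≫ g) := Iso.refl _

lemma preservesEpimorphisms_pushforward {f : Y ⟶ Z} (hf : IsClosedEmbedding f) :
    (TopCat.Sheaf.pushforward (ModuleCat.{u} R) f).PreservesEpimorphisms where
  preserves {G H} φ hφ := by
    rw [← TopCat.Sheaf.isLocallySurjective_iff_epi] at hφ ⊢
    rw [TopCat.Presheaf.isLocallySurjective_iff] at hφ ⊢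
    intro V t z hz
    by_cases hzf : ∃ y, f y = z
    · obtain ⟨y, rfl⟩ := hzf
      obtain ⟨W, hW, ⟨s, hs⟩, hy⟩ := hφ ((Opens.map f).obj V) t y hz
      obtain ⟨W', hW', h⟩ := hf.isInducing.isOpen_iff.1 W.isOpen
      have hWV : W = (Opens.map f).obj (V ⊓ ⟨W', hW'⟩) := by
        ext y
        refine ⟨fun hy => ⟨hW hy, h.symm.subset hy⟩, fun hy => h.subset hy.2⟩
      subst hWV
      exact ⟨V ⊓ ⟨W', hW'⟩, inf_le_left, ⟨s, hs⟩, hy⟩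
    -- Off the closed image of `f`, the sections of the pushforward vanish, so `0` is a lift.
    · let V' : Opens Z := V ⊓ ⟨(Set.range f)ᶜ, hf.isClosed_range.isOpen_compl⟩
      have hV' : (Opens.map f).obj V' = ⊥ := by
        ext y
        simp [V']
      have hs : Subsingleton (ToType (H.obj.obj (Opposite.op ((Opens.map f).obj V')))) := by
        rw [hV']
        exact ModuleCat.subsingleton_of_isZero
          ((isZero_zero _).of_iso (H.isTerminalOfEmpty.uniqueUpToIso (isZero_zero _).isTerminal))
      exact ⟨V', inf_le_left, ⟨0, hs.elim _ _⟩, hz, hzf⟩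

lemma preservesFiniteColimits_pushforward {f : Y ⟶ Z} (hf : IsClosedEmbedding f) :
    PreservesFiniteColimits (TopCat.Sheaf.pushforward (ModuleCat.{u} R) f) := by
  have := preservesEpimorphisms_pushforward R hf
  refine ((Functor.preservesFiniteColimits_tfae _).out 0 3).1 fun S hS => ?_
  have := hS.mono_f
  have := hS.epi_g
  have hlim : PreservesFiniteLimits (TopCat.Sheaf.pushforward (ModuleCat.{u} R) f) := inferInstance
  rw [((Functor.preservesFiniteLimits_tfae
    (TopCat.Sheaf.pushforward (ModuleCat.{u} R) f)).out 3 0 :)] at hlim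
  exact ⟨(hlim S hS).1,
    inferInstanceAs (Epi ((TopCat.Sheaf.pushforward (ModuleCat.{u} R) f).map S.g))⟩

variable {R}

instance (f : Y ⟶ Z) : (derivedPushforward (R := R) f).Additive :=
  inferInstanceAs ((TopCat.Sheaf.pushforward (ModuleCat.{u} R) f).rightDerivedFunctorPlus).Additive

instance (a : ℤ) : (truncLE (R := R) (Y := Y) a).Additive :=
  inferInstanceAs ((DerivedCategory.Plus.TStructure.t (C := ModSheaf R Y)).truncLE a).Additive

lemma nonempty_derivedPushforward_comp {f : Y ⟶ Z} {g : Z ⟶ T} {h : Y ⟶ T} (w : f ≫ g = h)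
    (K : DPlus R Y) :
    Nonempty ((derivedPushforward h).obj K ≅
      (derivedPushforward g).obj ((derivedPushforward f).obj K)) := by
  subst w
  exact Functor.nonempty_rightDerivedFunctorPlus_comp _ _ _ (pushforwardCompIso R f g) K

lemma nonempty_truncLE_derivedPushforward {f : Y ⟶ Z} (hf : IsClosedEmbedding f) (a : ℤ)
    (K : DPlus R Y) :
    Nonempty ((truncLE a).obj ((derivedPushforward f).obj K) ≅
      (derivedPushforward f).obj ((truncLE a).obj K)) := by
  have := preservesFiniteColimits_pushforward R hf
  exact Functor.nonempty_truncLE_rightDerivedFunctorPlus _ K a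

lemma nonempty_derivedPushforward_shiftedSheaf {f : Y ⟶ Z} (hf : IsClosedEmbedding f)
    (G : ModSheaf R Y) (d : ℤ) :
    Nonempty ((derivedPushforward f).obj (shiftedSheaf G d) ≅
      shiftedSheaf ((TopCat.Sheaf.pushforward (ModuleCat.{u} R) f).obj G) d) := by
  have := preservesFiniteColimits_pushforward R hf
  exact Functor.nonempty_rightDerivedFunctorPlus_shift_single _ G d

/-- The complex `Rf_* G[d]` lives in degrees at least `-d`, so truncations below `-d` kill it. -/
lemma isZero_truncLE_derivedPushforward_shiftedSheaf (f : Y ⟶ Z) (G : ModSheaf R Y) {d a : ℤ}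
    (h : a < -d) :
    IsZero ((truncLE a).obj ((derivedPushforward f).obj (shiftedSheaf G d))) := by
  have h₁ : (shiftedSheaf G d).IsGE (-d) :=
    DerivedCategory.Plus.TStructure.t.isGE_shift _ 0 d (-d)
  have h₂ : ((derivedPushforward f).obj (shiftedSheaf G d)).IsGE (-d) :=
    Functor.isGE_rightDerivedFunctorPlus_obj _ _ _
  have := DerivedCategory.Plus.TStructure.t.isGE_of_ge
    ((derivedPushforward f).obj (shiftedSheaf G d)) (a + 1) (-d)
  exact DerivedCategory.Plus.TStructure.t.isZero_truncLE_obj_of_isGE a (a + 1) rfl _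

end Pushforward

/-! ### The closed subsets `X^m ∩ U_k` of `U_k` -/

section PureInclusion

variable {n : ℕ} {X : Type u} [TopologicalSpace X] {F : ℤ → Set X}

lemma isOpen_openStrata (F : ℤ → Set X) (m : ℕ) : IsOpen (openStrata F m) := by
  refine isOpen_iff_mem_nhds.2 fun x hx =>
    Filter.mem_of_superset (hx.2.mem_nhds (mem_connectedComponentIn hx.1)) fun y hy => ?_
  exact ⟨connectedComponentIn_subset _ _ hy, connectedComponentIn_eq hy ▸ hx.2⟩

lemma openStrata_disjoint_pureClosure (hF : Monotone F) {l m : ℕ} (h : l ≠ m) :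
    Disjoint (openStrata F l) (pureClosure F m) := by
  refine Disjoint.closure_right (Set.disjoint_left.2 fun x hl hm => ?_) (isOpen_openStrata F l)
  rcases lt_or_gt_of_ne h with h | h
  · exact hm.1.2 (hF (by omega) hl.1.1)
  · exact hl.1.2 (hF (by omega) hm.1.1)

/-- The subset `X^m ∖ X_{m-i-1}` of `X^m` lies in `U_{k+1}` if `m + k = n + i`. It is part of
`W_{k+1}` if `i` is positive, and it is equal to `U^m` if `i = 0`. -/
lemma IsEvenStratification.mem_openFilt (hF : IsEvenStratification n F) {m k i : ℕ}
    (hm : 1 ≤ m ∧ m ≤ n) (h : m + k = n + i) (x : pureOpenFilt m (pureFilt F m) (i + 1)) :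
    (x.1 : X) ∈ openFilt n F (k + 1) := by
  obtain ⟨x, hx⟩ := x
  have hx' : (x : X) ∉ F (m - (i + 1 : ℕ)) := hx
  rcases i with _ | i
  · exact Or.inr ⟨m, hm.1, by omega, hF.pureClosure_diff m ▸ ⟨x.2, by simpa using hx'⟩⟩
  · refine Or.inl ⟨m, hm.1, hm.2, by omega, x.2, ?_⟩
    rwa [show (n : ℤ) - (k + 1 : ℕ) = m - (i + 1 + 1 : ℕ) by push_cast; omega]

/-- The inclusion of `U^m_{i+1} = X^m ∖ X_{m-i-1}` into `U_{k+1}`, where `m + k = n + i`. -/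
def IsEvenStratification.pureIncl (hF : IsEvenStratification n F) {m k i : ℕ}
    (hm : 1 ≤ m ∧ m ≤ n) (h : m + k = n + i) :
    TopCat.of (pureOpenFilt m (pureFilt F m) (i + 1)) ⟶ TopCat.of (openFilt n F (k + 1)) :=
  TopCat.ofHom ⟨fun x => ⟨x.1, hF.mem_openFilt hm h x⟩, by fun_prop⟩

/-- As a subset of `U_{k+1}`, the set `X^m ∖ X_{m-i-1}` is `X^m ∩ U_{k+1}`, for `m + k = n + i`:
the points of `W_{k+1}` avoid `X_{n-k-1} = X_{m-i-1}`, and the open sets `U^l` with `l ≠ m` do not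
meet `X^m`. -/
lemma IsEvenStratification.range_pureIncl (hF : IsEvenStratification n F) {m k i : ℕ}
    (hm : 1 ≤ m ∧ m ≤ n) (h : m + k = n + i) :
    Set.range (hF.pureIncl hm h) = Subtype.val ⁻¹' pureClosure F m := by
  ext ⟨x, hx⟩
  constructor
  · rintro ⟨y, hy⟩
    obtain rfl : (y.1 : X) = x := congrArg Subtype.val hy
    exact y.1.2
  · intro (hxm : x ∈ pureClosure F m)
    suffices hx' : x ∉ F (m - (i + 1 : ℕ)) from ⟨⟨⟨x, hxm⟩, hx'⟩, rfl⟩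
    rcases hx with ⟨l, -, -, -, -, hx⟩ | ⟨l, -, -, hx⟩
    · rwa [show (m : ℤ) - (i + 1 : ℕ) = n - (k + 1 : ℕ) by push_cast; omega]
    · obtain rfl : l = m := by
        by_contra hlm
        exact (openStrata_disjoint_pureClosure hF.monotone hlm).le_bot ⟨hx, hxm⟩
      exact fun hx' => hx.1.2 (hF.monotone (by push_cast; omega) hx')

lemma IsEvenStratification.isClosedEmbedding_pureIncl (hF : IsEvenStratification n F) {m k i : ℕ}
    (hm : 1 ≤ m ∧ m ≤ n) (h : m + k = n + i) : IsClosedEmbedding (hF.pureIncl hm h) where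
  toIsEmbedding := .of_comp (g := Subtype.val) (hF.pureIncl hm h).hom.continuous
    continuous_subtype_val (show IsEmbedding (Subtype.val ∘ Subtype.val) from
      IsEmbedding.subtypeVal.comp IsEmbedding.subtypeVal)
  isClosed_range := by
    rw [hF.range_pureIncl hm h]
    exact isClosed_closure.preimage continuous_subtype_val

end PureInclusion

/-! ### A decomposition of biproducts -/

/-- If the `A j` with `p j` are zero, then adding the `T j` with `p j` to `⨁ A` amounts to replacing
`A j` by `T j` for these `j`. -/
lemma nonempty_biprod_biproduct_subtype_iso {C : Type*} [Category* C] [Preadditive C]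
    [HasFiniteBiproducts C] [HasBinaryBiproducts C] {J : Type*} [Finite J] (p : J → Prop)
    (A T : J → C)
    (hA : ∀ j, p j → IsZero (A j)) (e : ∀ j, ¬ p j → Nonempty (A j ≅ T j)) :
    Nonempty ((⨁ A) ⊞ (⨁ fun j : {j // p j} => T j) ≅ ⨁ T) := by
  classical
  refine ⟨⟨biprod.desc
      (biproduct.desc fun j => if h : p j then 0 else (e j h).some.hom ≫ biproduct.ι T j)
      (biproduct.desc fun j => biproduct.ι T j),
    biproduct.desc fun j => if h : p j then
        biproduct.ι (fun j : {j // p j} => T j) ⟨j, h⟩ ≫ biprod.inr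
      else (e j h).some.inv ≫ biproduct.ι A j ≫ biprod.inl, ?_, ?_⟩⟩
  · ext1
    · refine biproduct.hom_ext' _ _ fun j => ?_
      by_cases h : p j
      · exact (hA j h).eq_of_src _ _
      · simp [h]
    · refine biproduct.hom_ext' _ _ fun j => ?_
      simp [j.2]
  · refine biproduct.hom_ext' _ _ fun j => ?_
    by_cases h : p j <;> simp [h]

/-! ### The summands of the modified Deligne construction -/

section Summands

variable {R : Type u} [CommRing R] {X : Type u} [TopologicalSpace X] {n : ℕ} {F : ℤ → Set X}

/-- The sheaf `L^m` on the open subset `X^m ∖ X_{m-1}` of `X^m`, which is equal to `U^m`. -/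
noncomputable def pureSheaf (L : ModSheaf R (TopCat.of (openFilt n F 1))) (m : ℕ)
    (hm : 1 ≤ m ∧ m ≤ n) : ModSheaf R (TopCat.of (pureOpenFilt m (pureFilt F m) 1)) :=
  (TopCat.Sheaf.pushforward (ModuleCat.{u} R) (openStrataToPure F m)).obj (componentSheaf L m hm)

/-- The contribution of `X^m` to the complex `I_{k+1}` on `U_{k+1}`. If `n ≤ m + k`, it is the
pushforward of the complex `I^m_{i+1}` with `i = m + k - n`, otherwise it is `L^m[m]`, extended by
zero. For `m + k = n` both descriptions apply, see `nonempty_extendedComponent_iso`. -/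
noncomputable def componentStage (hF : IsEvenStratification n F)
    (L : ModSheaf R (TopCat.of (openFilt n F 1))) (k m : ℕ) (hm : 1 ≤ m ∧ m ≤ n) :
    DPlus R (TopCat.of (openFilt n F (k + 1))) :=
  if h : n ≤ m + k then
    (derivedPushforward (hF.pureIncl hm (i := m + k - n) (by omega))).obj
      (pureDeligne m (pureFilt_monotone hF.monotone m) (pureSheaf L m hm) (m + k - n))
  else extendedComponent L (k + 1) (by omega) m (by omega)

variable (hF : IsEvenStratification n F) (L : ModSheaf R (TopCat.of (openFilt n F 1)))

lemma nonempty_componentStage_iso_pure {k m i : ℕ} (hm : 1 ≤ m ∧ m ≤ n) (h : m + k = n + i) :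
    Nonempty (componentStage hF L k m hm ≅ (derivedPushforward (hF.pureIncl hm h)).obj
      (pureDeligne m (pureFilt_monotone hF.monotone m) (pureSheaf L m hm) i)) := by
  obtain rfl : i = m + k - n := by omega
  exact ⟨eqToIso (dif_pos (by omega))⟩

/-- In the overlapping case `m + k = n`, this uses that the pushforward along a closed embedding is
exact. -/
lemma nonempty_extendedComponent_iso {k m : ℕ} (hm : 1 ≤ m ∧ m ≤ n) (h : m + (k + 1) ≤ n + 1) :
    Nonempty (extendedComponent L (k + 1) (by omega) m ⟨hm.1, h⟩ ≅
      componentStage hF L k m hm) := by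
  rcases Nat.lt_or_ge (m + k) n with h' | h'
  · exact ⟨eqToIso (by rw [componentStage, dif_neg (Nat.not_le.2 h')])⟩
  · have h₀ : m + k = n + 0 := by omega
    obtain ⟨e⟩ := nonempty_componentStage_iso_pure hF L hm h₀
    obtain ⟨e'⟩ := nonempty_derivedPushforward_shiftedSheaf (hF.isClosedEmbedding_pureIncl hm h₀)
      (pureSheaf L m hm) m
    exact ⟨e'.symm ≪≫ e.symm⟩

/-- The contribution of `X^m` follows the usual Deligne construction as soon as `n ≤ m + k`. -/
lemma nonempty_truncLE_componentStage {k m : ℕ} (hm : 1 ≤ m ∧ m ≤ n) (h : n ≤ m + k) :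
    Nonempty ((truncLE ((k : ℤ) - n)).obj
      ((derivedPushforward (subsetIncl (openFilt_subset_succ n hF.monotone k))).obj
        (componentStage hF L k m hm)) ≅ componentStage hF L (k + 1) m hm) := by
  obtain ⟨i, hi⟩ := Nat.exists_eq_add_of_le h
  have hi' : m + (k + 1) = n + (i + 1) := by omega
  obtain ⟨e₁⟩ := nonempty_componentStage_iso_pure hF L hm hi
  obtain ⟨e₂⟩ := nonempty_componentStage_iso_pure hF L hm hi'
  let K := pureDeligne m (pureFilt_monotone hF.monotone m) (pureSheaf L m hm) i
  let j := subsetIncl (pureOpenFilt_subset_succ m (pureFilt_monotone hF.monotone m) (i + 1))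
  obtain ⟨e₃⟩ := nonempty_derivedPushforward_comp (R := R) (f := hF.pureIncl hm hi)
    (g := subsetIncl (openFilt_subset_succ n hF.monotone k)) rfl K
  obtain ⟨e₄⟩ := nonempty_derivedPushforward_comp (R := R) (f := j) (g := hF.pureIncl hm hi')
    (h := hF.pureIncl hm hi ≫ subsetIncl (openFilt_subset_succ n hF.monotone k)) rfl K
  obtain ⟨e₅⟩ := nonempty_truncLE_derivedPushforward (hF.isClosedEmbedding_pureIncl hm hi')
    ((i : ℤ) - m) ((derivedPushforward j).obj K)
  rw [show (k : ℤ) - n = i - m by omega]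
  exact ⟨(truncLE _).mapIso ((derivedPushforward _).mapIso e₁ ≪≫ e₃.symm ≪≫ e₄) ≪≫ e₅ ≪≫ e₂.symm⟩

lemma isZero_truncLE_componentStage {k m : ℕ} (hm : 1 ≤ m ∧ m ≤ n) (h : m + k < n) :
    IsZero ((truncLE ((k : ℤ) - n)).obj
      ((derivedPushforward (subsetIncl (openFilt_subset_succ n hF.monotone k))).obj
        (componentStage hF L k m hm))) := by
  obtain ⟨e⟩ := nonempty_extendedComponent_iso hF L hm (k := k) (by omega)
  exact (isZero_truncLE_derivedPushforward_shiftedSheaf _ _ (by omega)).of_iso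
    (((derivedPushforward _) ⋙ (truncLE _)).mapIso e.symm)

lemma nonempty_modifiedDeligne_iso (k : ℕ) :
    Nonempty (modifiedDeligne n hF.monotone L k ≅
      ⨁ fun m : {m : ℕ // m ∈ Finset.Icc 1 n} =>
        componentStage hF L k m.1 (Finset.mem_Icc.mp m.2)) := by
  induction k with
  | zero =>
    exact ⟨biproduct.mapIso fun m => (nonempty_extendedComponent_iso hF L (k := 0)
      (Finset.mem_Icc.mp m.2) (by have := Finset.mem_Icc.mp m.2; omega)).some⟩
  | succ k ih =>
    obtain ⟨e⟩ := ih
    let Φ : DPlus R (TopCat.of (openFilt n F (k + 1))) ⥤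
        DPlus R (TopCat.of (openFilt n F (k + 2))) :=
      derivedPushforward (subsetIncl (openFilt_subset_succ n hF.monotone k)) ⋙
        truncLE ((k : ℤ) - n)
    have : Φ.Additive := inferInstanceAs (Functor.Additive (_ ⋙ _))
    obtain ⟨e'⟩ := nonempty_biprod_biproduct_subtype_iso
      (J := {m : ℕ // m ∈ Finset.Icc 1 n}) (fun m => m.1 + k < n)
      (fun m => Φ.obj (componentStage hF L k m.1 (Finset.mem_Icc.mp m.2)))
      (fun m => componentStage hF L (k + 1) m.1 (Finset.mem_Icc.mp m.2))
      (fun m hm => isZero_truncLE_componentStage hF L (Finset.mem_Icc.mp m.2) hm)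
      (fun m hm => nonempty_truncLE_componentStage hF L (Finset.mem_Icc.mp m.2) (not_lt.mp hm))
    -- For `m ≥ 1`, the condition `m ≤ n - (k + 1)` is equivalent to `m + k < n`, also when the
    -- subtraction is truncated.
    let ε : {m : ℕ // m ∈ Finset.Icc 1 (n - (k + 1))} ≃
        {m : {m : ℕ // m ∈ Finset.Icc 1 n} // m.1 + k < n} :=
      { toFun := fun m => ⟨⟨m.1, by have := Finset.mem_Icc.mp m.2; simp; omega⟩,
          by have := Finset.mem_Icc.mp m.2; simp; omega⟩
        invFun := fun m => ⟨m.1.1, by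
          have := Finset.mem_Icc.mp m.1.2; have := m.2; simp; omega⟩
        left_inv := fun _ => rfl
        right_inv := fun _ => rfl }
    exact ⟨biprod.mapIso (Φ.mapIso e ≪≫ Φ.mapBiproduct _)
      (biproduct.whiskerEquiv ε fun m => (nonempty_extendedComponent_iso hF L (k := k + 1)
        (Finset.mem_Icc.mp (ε m).1.2) (by have := (ε m).2; omega)).some.symm) ≪≫ e'⟩

end Summands

theorem mainTheorem4 {R : Type u} [CommRing R] {X : Type u} [TopologicalSpace X] (n : ℕ)
    (F : ℤ → Set X) (hF : IsEvenStratification n F)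
    (L : ModSheaf R (TopCat.of (openFilt n F 1))) (hL : IsLocalSystem L) :
    Nonempty (modifiedIC n hF.monotone L ≅
      ⨁ fun m : {m : ℕ // m ∈ Finset.Icc 1 n} =>
        (derivedPushforward (valIncl (pureClosure F m.1))).obj
          (componentIC hF.monotone L m.1 (Finset.mem_Icc.mp m.2))) := by
  obtain ⟨e⟩ := nonempty_modifiedDeligne_iso hF L n
  -- Both sides are the derived pushforward of `I^m_{m+1}` along the same map to `X`.
  have key (m : {m : ℕ // m ∈ Finset.Icc 1 n}) :
      Nonempty ((derivedPushforward (valIncl (openFilt n F (n + 1)))).obj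
          (componentStage hF L n m.1 (Finset.mem_Icc.mp m.2)) ≅
        (derivedPushforward (valIncl (pureClosure F m.1))).obj
          (componentIC hF.monotone L m.1 (Finset.mem_Icc.mp m.2))) := by
    have hm := Finset.mem_Icc.mp m.2
    have hi : m.1 + n = n + m.1 := add_comm _ _
    obtain ⟨e₁⟩ := nonempty_componentStage_iso_pure hF L hm hi
    let K := pureDeligne m.1 (pureFilt_monotone hF.monotone m.1) (pureSheaf L m.1 hm) m.1
    obtain ⟨e₂⟩ := nonempty_derivedPushforward_comp (R := R) (f := hF.pureIncl hm hi)
      (g := valIncl (openFilt n F (n + 1))) rfl K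
    obtain ⟨e₃⟩ := nonempty_derivedPushforward_comp (R := R)
      (f := valIncl (pureOpenFilt m.1 (pureFilt F m.1) (m.1 + 1)))
      (g := valIncl (pureClosure F m.1))
      (h := hF.pureIncl hm hi ≫ valIncl (openFilt n F (n + 1))) rfl K
    exact ⟨(derivedPushforward _).mapIso e₁ ≪≫ e₂.symm ≪≫ e₃⟩
  exact ⟨(derivedPushforward _).mapIso e ≪≫ (derivedPushforward _).mapBiproduct _ ≪≫
    biproduct.mapIso fun m => (key m).some⟩
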